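/- \textbf{Setting.} Let $d\ge 1$, $d_L\ge 0$, $M\ge 4$, and let $\mathcal G=(V,E)$ be the hypercubic lattice with $N=M^{d_L}$ vertices $V=\{0,\dots,M-1\}^{d_L}$, in which two vertices are joined by an edge if they differ by a unit vector (open boundary conditions) or if they do so modulo $M$ (periodic boundary conditions). Its coordination number is $z=2d_L$. Let $\mathcal H=\bigotimes_{n\in V}\mathbb C^d$. Let $\delta$ be the graph distance. For $A\subset V$ let $a=\{n\notin A:\delta(n,A)\le 1\}$, $\bar A=A\cup a$, $b=\{n\notin A:\delta(n,A)\le 2\}\setminus a$, $B=V\setminus(\bar A\cup b)$, $\bar B=B\cup b=V\setminus\bar A$, and let $S$ be the set of all $A\subset V$ with $B\ne\emptyset$. For $C\subset V$, $X_C$ denotes an operator supported on $C$ (identified with $X_C\otimes\mathbb 1$) and $\mathrm{tr}_C$ the partial trace over the qudits in $C$. A channel is a completely positive trace-preserving linear map on $L(\mathcal H)$; $\mathcal E^\dagger$ is its Hilbert--Schmidt adjoint. A channel $\mathcal E$ is \emph{causality preserving} (a CPQC) if for all $A\in S$ and all $X_A$ there is $Y_{\bar A}$ with $\mathcal E^\dagger(X_A)=Y_{\bar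 A}$; a quantum cellular automaton (QCA) is a unitary CPQC. It is \emph{locality preserving} (an LPQC) if for all $A\in S$ and all $\rho_{\bar A},\rho_{\bar B}\ge 0$, $$\mathrm{tr}_{a,b}\left[\mathcal E(\rho_{\bar A}\rho_{\bar B})\right]=\frac1{d^N}\,\mathrm{tr}_{a,\bar B}\left[\mathcal E(\rho_{\bar A})\right]\,\mathrm{tr}_{\bar A,b}\left[\mathcal E(\rho_{\bar B})\right].$$ A \emph{PEPU} of bond dimension $D$ for a unitary $U$ consists of one tensor per vertex, with one index in $\{1,\dots,D\}$ for each incident edge and two physical indices (output and input) in $\{1,\dots,d\}$, such that contracting the edge indices along all the edges of $\mathcal G$ gives the matrix elements $U_{s,t}$ in the computational basis. For $O,I\subset V$, let $K_{O,I}$ be the double layer formed by this network and its complex conjugate, with the output indices in $O$ and the input indices in $I$ contracted between the two layers and all other physical indices left open. The PEPU is \emph{simple} if for all $A\in S$ $$K_{a\cup b,\emptyset}=\left(\frac{1}{d^{|\bar B|}}K_{a\cup\bar B,\bar B}\right)\otimes\left(\frac{1}{d^{|\bar A|}}K_{\bar A\cup b,\bar A}\right),$$ i.e. the double layer with traced outputs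 in $a\cup b$ is the product of a tensor on $A$ (outputs) and $\bar A$ (inputs) and a tensor on $B$ (outputs) and $\bar B$ (inputs). \textbf{Theorem.} There is a function $D_0=D_0(d,d_L,z)$, independent of $M$, of the boundary conditions and of $U$, such that for every lattice as above, every unitary $U$ on $\mathcal H$ and every $D\ge D_0(d,d_L,z)$, the following statements about the unitary channel $\mathcal E(\rho)=U\rho U^\dagger$ are equivalent: (i) $\mathcal E$ is a QCA (that is, a CPQC); (ii) $\mathcal E$ is an LPQC; (iii) $U$ is represented by a simple PEPU of bond dimension $D$. -/

import Mathlib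

namespace QCA

open scoped ComplexOrder

/-! ### Quantum channels on a finite-dimensional Hilbert space with orthonormal basis `n` -/

section Channel

variable {n : Type*} [Fintype n] [DecidableEq n]

/-- The map `E ⊗ id` on operators on `ℂⁿ ⊗ ℂᵏ`. -/
def ampliation (E : Matrix n n ℂ →ₗ[ℂ] Matrix n n ℂ) (k : ℕ)
    (X : Matrix (n × Fin k) (n × Fin k) ℂ) : Matrix (n × Fin k) (n × Fin k) ℂ :=
  Matrix.of fun p q => E (Matrix.of fun i j => X (i, p.2) (j, q.2)) p.1 q.1

/-- A quantum channel: a completely positive trace-preserving linear map. -/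
structure Channel (n : Type*) [Fintype n] [DecidableEq n] where
  toLin : Matrix n n ℂ →ₗ[ℂ] Matrix n n ℂ
  completelyPositive : ∀ (k : ℕ) (X : Matrix (n × Fin k) (n × Fin k) ℂ),
    X.PosSemidef → (ampliation toLin k X).PosSemidef
  tracePreserving : ∀ X : Matrix n n ℂ, (toLin X).trace = X.trace

/-- The adjoint of a channel for the Hilbert-Schmidt inner product `⟨X, Y⟩ = tr (Xᴴ Y)`;
see `Channel.trace_adjoint`. -/
def Channel.adjoint (E : Channel n) (X : Matrix n n ℂ) : Matrix n n ℂ :=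
  Matrix.of fun i j => ((E.toLin (Matrix.single i j 1)).conjTranspose * X).trace

theorem Channel.trace_adjoint (E : Channel n) (X Y : Matrix n n ℂ) :
    ((E.adjoint X).conjTranspose * Y).trace = (X.conjTranspose * E.toLin Y).trace := by
  have hY : E.toLin Y = ∑ i, ∑ j, Y i j • E.toLin (Matrix.single i j 1) := by
    conv_lhs => rw [Matrix.matrix_eq_sum_single Y]
    simp only [map_sum]
    refine Finset.sum_congr rfl fun i _ => Finset.sum_congr rfl fun j _ => ?_
    rw [← map_smul, Matrix.smul_single, smul_eq_mul, mul_one]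
  rw [hY]
  simp only [Matrix.mul_sum, Matrix.trace_sum, Matrix.mul_smul, Matrix.trace_smul, smul_eq_mul]
  rw [Finset.sum_comm]
  simp only [Matrix.trace, Matrix.diag_apply, Matrix.mul_apply, Matrix.conjTranspose_apply,
    Channel.adjoint, Matrix.of_apply, star_sum, star_mul', star_star, Finset.sum_mul,
    Finset.mul_sum]
  refine Finset.sum_congr rfl fun i _ => Finset.sum_congr rfl fun j _ =>
    Finset.sum_congr rfl fun k _ => Finset.sum_congr rfl fun l _ => ?_
  ring

theorem ampliation_conj {n : Type*} [Fintype n] (U : Matrix n n ℂ) (E : Matrix n n ℂ →ₗ[ℂ] Matrix n n ℂ)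
    (hE : ∀ X, E X = U * X * U.conjTranspose) (k : ℕ)
    (X : Matrix (n × Fin k) (n × Fin k) ℂ) :
    ampliation E k X = Matrix.kronecker U (1 : Matrix (Fin k) (Fin k) ℂ) * X *
      (Matrix.kronecker U (1 : Matrix (Fin k) (Fin k) ℂ)).conjTranspose := by
  ext p q
  simp [ampliation, hE, Matrix.mul_apply, Fintype.sum_prod_type, Matrix.one_apply,
    Matrix.kroneckerMap_apply, Matrix.conjTranspose_apply, apply_ite]

/-- The unitary channel `X ↦ U X Uᴴ`. -/
def unitaryChannel (U : Matrix.unitaryGroup n ℂ) : Channel n where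
  toLin :=
    { toFun := fun X => (U : Matrix n n ℂ) * X * (U : Matrix n n ℂ).conjTranspose
      map_add' := fun X Y => by rw [mul_add, add_mul]
      map_smul' := fun c X => by simp }
  completelyPositive := fun k X hX => by
    rw [ampliation_conj (U : Matrix n n ℂ) _ (fun _ => rfl)]
    exact hX.mul_mul_conjTranspose_same _
  tracePreserving := fun X => by
    change ((U : Matrix n n ℂ) * X * (U : Matrix n n ℂ).conjTranspose).trace = X.trace
    rw [Matrix.trace_mul_comm, ← mul_assoc]
    have h : (U : Matrix n n ℂ).conjTranspose * (U : Matrix n n ℂ) = 1 :=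
      Matrix.UnitaryGroup.star_mul_self U
    rw [h, one_mul]

end Channel

/-! ### Many-body operators: one qudit of dimension `d` on each vertex of `V` -/

section Operators

variable {V : Type*} [Fintype V] [DecidableEq V]

/-- Labels of the computational basis of the qudits in `V`. -/
abbrev Config (V : Type*) (d : ℕ) : Type _ := V → Fin d

/-- Operators on the Hilbert space of all the qudits. -/
abbrev Op (V : Type*) (d : ℕ) : Type _ := Matrix (Config V d) (Config V d) ℂ

/-- Operators on the Hilbert space of the qudits in the region `C`. -/
abbrev LocalOp {V : Type*} (C : Finset V) (d : ℕ) : Type _ := Op {v // v ∈ C} d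

/-- The configuration that agrees with `o` on `C` and with `s` off `C`. -/
def override {d : ℕ} (C : Finset V) (s : Config V d) (o : Config {v // v ∈ C} d) : Config V d :=
  fun v => if h : v ∈ C then o ⟨v, h⟩ else s v

/-- `X ⊗ 𝟙`: an operator on the region `C` as an operator on all the qudits. -/
def embed {d : ℕ} (C : Finset V) (X : LocalOp C d) : Op V d :=
  Matrix.of fun s t => if ∀ v, v ∉ C → s v = t v then X (fun v => s v) (fun v => t v) else 0

/-- The partial trace over the qudits in the region `C`. -/
def partialTrace {d : ℕ} (C : Finset V) (X : Op V d) : LocalOp Cᶜ d :=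
  Matrix.of fun s t => ∑ o : Config {v // v ∈ C} d,
    X (fun v => if h : v ∈ C then o ⟨v, h⟩ else s ⟨v, Finset.mem_compl.mpr h⟩)
      (fun v => if h : v ∈ C then o ⟨v, h⟩ else t ⟨v, Finset.mem_compl.mpr h⟩)

/-- The partial trace over the qudits in `C`, as an operator supported on the complement of `C`. -/
def tr {d : ℕ} (C : Finset V) (X : Op V d) : Op V d := embed Cᶜ (partialTrace C X)

end Operators

/-! ### Regions of a graph -/

section Regions

variable {V : Type*} [Fintype V] [DecidableEq V] (G : SimpleGraph V) (A : Finset V)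

open Classical in
/-- The vertices outside `A` at graph distance at most `r` from `A`. -/
noncomputable def neighborhood (r : ℕ) : Finset V :=
  Finset.univ.filter fun n => n ∉ A ∧ ∃ m ∈ A, G.edist n m ≤ r

/-- `a`: the neighborhood of `A`. -/
noncomputable def regA : Finset V := neighborhood G A 1

/-- `Ā = A ∪ a`. -/
noncomputable def regABar : Finset V := A ∪ regA G A

/-- `b`: the next-nearest neighborhood of `A`. -/
noncomputable def regB : Finset V := neighborhood G A 2 \ regA G A

/-- `B = V \ (Ā ∪ b)`. -/
noncomputable def regFar : Finset V := (regABar G A ∪ regB G A)ᶜ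

/-- `B̄ = B ∪ b`. -/
noncomputable def regFarBar : Finset V := regFar G A ∪ regB G A

/-- The family `S` of the regions `A` for which `B` is not empty. -/
def Admissible : Prop := (regFar G A).Nonempty

end Regions

/-! ### Causality-preserving and locality-preserving channels -/

section Locality

variable {V : Type*} [Fintype V] [DecidableEq V] {d : ℕ}

/-- Causality-preserving quantum channels (of range one): in the Heisenberg picture, operators on
`A` are mapped to operators on `Ā`. -/
def IsCPQC (G : SimpleGraph V) (E : Channel (Config V d)) : Prop :=
  ∀ A : Finset V, Admissible G A → ∀ X : LocalOp A d,
    ∃ Y : LocalOp (regABar G A) d, E.adjoint (embed A X) = embed (regABar G A) Y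

/-- Locality-preserving quantum channels:
`tr_{a,b} E(ρ_Ā ρ_B̄) = d⁻ᴺ tr_{a,B̄} E(ρ_Ā) tr_{Ā,b} E(ρ_B̄)` for all positive semidefinite
`ρ_Ā`, `ρ_B̄`. -/
def IsLPQC (G : SimpleGraph V) (E : Channel (Config V d)) : Prop :=
  ∀ A : Finset V, Admissible G A →
    ∀ (ρ : LocalOp (regABar G A) d) (σ : LocalOp (regFarBar G A) d),
      ρ.PosSemidef → σ.PosSemidef →
      tr (regA G A ∪ regB G A)
          (E.toLin (embed (regABar G A) ρ * embed (regFarBar G A) σ)) =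
        (1 / (d : ℂ) ^ Fintype.card V) •
          (tr (regA G A ∪ regFarBar G A) (E.toLin (embed (regABar G A) ρ)) *
            tr (regABar G A ∪ regB G A) (E.toLin (embed (regFarBar G A) σ)))

end Locality

/-! ### Tensor networks -/

section TensorNetwork

variable {V : Type*} [Fintype V] [DecidableEq V] {d D : ℕ}

/-- The tensors of a projected entangled pair operator of bond dimension `D` on the graph `G`: at
each vertex, one auxiliary index in `Fin D` for each incident edge and two physical indices (output
and input) in `Fin d`. -/
abbrev PEPO (G : SimpleGraph V) (d D : ℕ) : Type _ :=
  (n : V) → (G.incidenceSet n → Fin D) → Fin d → Fin d → ℂ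

open Classical in
/-- The operator obtained by contracting the auxiliary indices along all the edges of `G`. -/
noncomputable def PEPO.contract {G : SimpleGraph V} (T : PEPO G d D) : Op V d :=
  Matrix.of fun s t => ∑ k : G.edgeSet → Fin D,
    ∏ n : V, T n (fun e => k ⟨e.1, e.2.1⟩) (s n) (t n)

/-- The double layer made of the network `T` (with output and input indices `p`, `x`) and of its
complex conjugate (with output and input indices `q`, `y`), where the output indices in the region
`O` and the input indices in the region `I` are contracted between the two layers. The values of
`p`, `q` on `O` and of `x`, `y` on `I` do not matter. -/
noncomputable def PEPO.doubleLayer {G : SimpleGraph V} (T : PEPO G d D) (O I : Finset V)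
    (p q x y : Config V d) : ℂ :=
  ∑ o : Config {v // v ∈ O} d, ∑ i : Config {v // v ∈ I} d,
    PEPO.contract T (override O p o) (override I x i) *
      star (PEPO.contract T (override O q o) (override I y i))

/-- A network is simple if, for all `A` in `S`, the double layer with contracted outputs in `a` and
`b` is the product of a tensor on `A` (outputs) and `Ā` (inputs) and a tensor on `B` (outputs) and
`B̄` (inputs), each of which is the double layer closed on the other side by the normalized
trace. -/
def PEPO.IsSimple {G : SimpleGraph V} (T : PEPO G d D) : Prop :=
  ∀ A : Finset V, Admissible G A → ∀ p q x y : Config V d,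
    PEPO.doubleLayer T (regA G A ∪ regB G A) ∅ p q x y =
      (1 / (d : ℂ) ^ (regFarBar G A).card *
          PEPO.doubleLayer T (regA G A ∪ regFarBar G A) (regFarBar G A) p q x y) *
        (1 / (d : ℂ) ^ (regABar G A).card *
          PEPO.doubleLayer T (regABar G A ∪ regB G A) (regABar G A) p q x y)

/-- `U` is represented by a simple projected entangled pair unitary of bond dimension `D`. -/
def HasSimplePEPU (G : SimpleGraph V) (D : ℕ) (U : Matrix.unitaryGroup (Config V d) ℂ) : Prop :=
  ∃ T : PEPO G d D, PEPO.contract T = (U : Op V d) ∧ PEPO.IsSimple T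

end TensorNetwork

/-! ### Hypercubic lattices -/

/-- The vertices of the hypercubic lattice with side `M` in `dL` dimensions. -/
abbrev Site (dL M : ℕ) : Type := Fin dL → Fin M

/-- The two kinds of boundary conditions. -/
inductive Boundary
  | openBoundary
  | periodicBoundary

/-- The graph of the hypercubic lattice. With open boundary conditions, two vertices are joined if
they differ by a unit vector; with periodic boundary conditions, if they do so modulo `M`. -/
def latticeGraph (dL M : ℕ) : Boundary → SimpleGraph (Site dL M)
  | .openBoundary => SimpleGraph.fromRel fun n m =>
      ∃ i, (m i : ℕ) = (n i : ℕ) + 1 ∧ ∀ j, j ≠ i → m j = n j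
  | .periodicBoundary => SimpleGraph.fromRel fun n m =>
      ∃ i, (m i : ℕ) = ((n i : ℕ) + 1) % M ∧ ∀ j, j ≠ i → m j = n j

end QCA

/-!
Write `𝓔 ρ = U ρ Uᴴ`. The two notions of locality and the simplicity of a network all reduce to one
bilinear identity, `Factorizes`: for `ρ`, `σ` supported on `Ā`, `B̄` and observables `X`, `Y` supported
on `A`, `B`,
`dᴺ tr (U ρ σ Uᴴ X Y) = tr (U ρ Uᴴ X) tr (U σ Uᴴ Y)`.
Positive semidefinite matrices span all matrices, and the entries of partial traces and of double
layers are traces against matrix units of regions (`unitOn`); hence `Factorizes` is the condition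
defining locality preservation (`isLPQC_iff_factorizes`) as well as simplicity
(`isSimple_iff_factorizes`).

Causality preservation gives `Factorizes` because `Uᴴ X U` is supported on `Ā` and, as the far region
`B` is itself admissible and its neighborhood misses `Ā`, `Uᴴ Y U` is supported on `B̄`; the normalized
trace is multiplicative on operators with disjoint supports (`IsCPQC.factorizes`). Conversely `Y = 1`
in `Factorizes` says that `Uᴴ X U` is an operator on `Ā` tensored with the identity
(`isCPQC_of_factorizes`).

It remains to find a network for an automaton. Fix a nonzero matrix element `U s₀ t₀`. Then
`Uᴴ |s₀⟩⟨s| U` is the product over the vertices `v` of the operators `Uᴴ |s₀ v⟩⟨s v| U`, each supported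
on the closed neighborhood of `v`, and its matrix element at `(t₀, t)` is `star (U s₀ t₀) * U s t`.
Expanding every factor in matrix units turns the product into a network: the bond between `v` and `w`
records the matrix unit with which the factor of `v` acts on `w` and vice versa, so that `d ^ 4` values
are enough (`exists_contractWith_eq_prod`, `exists_contractWith_eq_of_local`). This uses that single
vertices are admissible, which holds for side at least six. The smaller lattices have at most
`5 ^ dL` vertices, and there every operator is a network whose bonds carry global configurations
(`exists_contractWith_eq_of_preconnected`).
-/

namespace QCA

open scoped ComplexOrder

/-! ### Product operators and matrix units of a region -/

section ProductOperators

variable {V : Type*} [Fintype V] {d : ℕ}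

/-- The tensor product `⨂ v, m v` of single-site operators. -/
def productOp (m : V → Matrix (Fin d) (Fin d) ℂ) : Op V d :=
  Matrix.of fun s t => ∏ v, m v (s v) (t v)

theorem productOp_one : productOp (1 : V → Matrix (Fin d) (Fin d) ℂ) = 1 := by
  ext s t
  simp only [productOp, Matrix.of_apply, Pi.one_apply, Matrix.one_apply]
  rw [Finset.prod_ite_zero]
  simp [funext_iff]

variable [DecidableEq V]

theorem productOp_mul (m m' : V → Matrix (Fin d) (Fin d) ℂ) :
    productOp (m * m') = productOp m * productOp m' := by
  ext s t
  simp only [productOp, Matrix.of_apply, Pi.mul_apply, Matrix.mul_apply]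
  rw [Finset.prod_univ_sum, Fintype.piFinset_univ]
  simp [Finset.prod_mul_distrib]

/-- `productOp` as a monoid homomorphism. -/
def productOpHom (V : Type*) [Fintype V] [DecidableEq V] (d : ℕ) :
    (V → Matrix (Fin d) (Fin d) ℂ) →* Op V d where
  toFun := productOp
  map_one' := productOp_one
  map_mul' := productOp_mul

theorem trace_productOp (m : V → Matrix (Fin d) (Fin d) ℂ) :
    (productOp m).trace = ∏ v, (m v).trace := by
  simp only [productOp, Matrix.trace, Matrix.diag_apply, Matrix.of_apply]
  rw [Finset.prod_univ_sum, Fintype.piFinset_univ]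

theorem trace_productOp_mul {m m' : V → Matrix (Fin d) (Fin d) ℂ} (h : ∀ v, m v = 1 ∨ m' v = 1) :
    (d : ℂ) ^ Fintype.card V * (productOp m * productOp m').trace =
      (productOp m).trace * (productOp m').trace := by
  rw [← productOp_mul, trace_productOp, trace_productOp, trace_productOp,
    ← Finset.prod_mul_distrib, ← Finset.card_univ, ← Finset.prod_const, ← Finset.prod_mul_distrib]
  refine Finset.prod_congr rfl fun v _ => ?_
  rcases h v with h | h <;> simp [h, mul_comm]

/-- The matrix unit `|x⟩⟨y|` of the qudits in the region `C`, tensored with the identity elsewhere.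
The values of `x` and `y` off `C` do not matter. -/
def unitOn (C : Finset V) (x y : Config V d) : Op V d :=
  productOp fun v => if v ∈ C then Matrix.single (x v) (y v) 1 else 1

theorem unitOn_apply (C : Finset V) (x y s t : Config V d) :
    unitOn C x y s t =
      if (∀ v ∈ C, x v = s v ∧ y v = t v) ∧ ∀ v ∉ C, s v = t v then 1 else 0 := by
  simp only [unitOn, productOp, Matrix.of_apply]
  have : ∀ v, (if v ∈ C then Matrix.single (x v) (y v) (1 : ℂ) else 1) (s v) (t v) =
      if (v ∈ C → x v = s v ∧ y v = t v) ∧ (v ∉ C → s v = t v) then 1 else 0 := by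
    intro v
    by_cases hv : v ∈ C <;> simp [hv, Matrix.single_apply, Matrix.one_apply]
  rw [Finset.prod_congr rfl fun v _ => this v, Finset.prod_ite_zero]
  simp [forall_and]

theorem unitOn_congr {C : Finset V} {x y x' y' : Config V d} (hx : ∀ v ∈ C, x v = x' v)
    (hy : ∀ v ∈ C, y v = y' v) : unitOn C x y = unitOn C x' y' := by
  unfold unitOn
  congr 1
  funext v
  split_ifs with h
  · rw [hx v h, hy v h]
  · rfl

theorem unitOn_univ (x y : Config V d) : unitOn Finset.univ x y = Matrix.single x y 1 := by
  ext s t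
  simp [unitOn_apply, Matrix.single_apply, funext_iff, forall_and]

theorem unitOn_union {A B : Finset V} (h : Disjoint A B) (x y : Config V d) :
    unitOn (A ∪ B) x y = unitOn A x y * unitOn B x y := by
  rw [unitOn, unitOn, unitOn, ← productOp_mul]
  congr 1
  funext v
  have : v ∈ A → v ∉ B := fun hv => Finset.disjoint_left.mp h hv
  by_cases hA : v ∈ A <;> by_cases hB : v ∈ B <;> simp_all

theorem unitOn_compl (C : Finset V) (x y : Config V d) :
    unitOn Cᶜ x y =
      ∑ o : Config {v // v ∈ C} d, Matrix.single (override C x o) (override C y o) 1 := by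
  ext s t
  rw [unitOn_apply, Matrix.sum_apply,
    Finset.sum_eq_single (fun v : {v // v ∈ C} => s v.1) _ (by simp)]
  · simp only [Matrix.single_apply]
    refine if_congr ?_ rfl rfl
    simp only [funext_iff, override, Finset.mem_compl]
    grind
  · intro o _ ho
    rw [Matrix.single_apply, if_neg]
    rintro ⟨h, -⟩
    refine ho (funext fun v => ?_)
    simp [← h, override]

theorem trace_mul_unitOn_compl (X : Op V d) (C : Finset V) (q p : Config V d) :
    (X * unitOn Cᶜ q p).trace =
      ∑ o : Config {v // v ∈ C} d, X (override C p o) (override C q o) := by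
  rw [unitOn_compl, Matrix.mul_sum, Matrix.trace_sum]
  simp [Matrix.trace_mul_single]

/-! ### Operators supported on a region -/

theorem embed_apply (C : Finset V) (X : LocalOp C d) (s t : Config V d) :
    embed C X s t = if ∀ v, v ∉ C → s v = t v then X (fun v => s v) (fun v => t v) else 0 :=
  rfl

theorem embed_single (C : Finset V) (x y : Config V d) :
    embed C (Matrix.single (fun v => x v) (fun v => y v) 1) = unitOn C x y := by
  ext s t
  simp only [embed, unitOn_apply, Matrix.of_apply, Matrix.single_apply, funext_iff, Subtype.forall]
  grind

theorem embed_add (C : Finset V) (X Y : LocalOp C d) :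
    embed C (X + Y) = embed C X + embed C Y := by
  ext s t
  simp only [embed, Matrix.of_apply, Matrix.add_apply]
  split_ifs <;> simp

theorem embed_smul (C : Finset V) (c : ℂ) (X : LocalOp C d) :
    embed C (c • X) = c • embed C X := by
  ext s t
  simp [embed]

theorem embed_zero (C : Finset V) : embed C (0 : LocalOp C d) = 0 := by
  ext s t
  simp [embed]

theorem embed_one (C : Finset V) : embed C (1 : LocalOp C d) = 1 := by
  ext s t
  simp only [embed, Matrix.of_apply, Matrix.one_apply, funext_iff, Subtype.forall]
  grind

/-- The operators supported on `C` are the span of the matrix units of `C`. -/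
theorem embed_induction [NeZero d] {C : Finset V} {P : Op V d → Prop}
    (add : ∀ X Y, P X → P Y → P (X + Y)) (smul : ∀ (c : ℂ) X, P X → P (c • X))
    (unit : ∀ x y, P (unitOn C x y)) (X : LocalOp C d) : P (embed C X) := by
  induction X using Matrix.induction_on' with
  | h_zero => rw [embed_zero, ← zero_smul ℂ (unitOn C 0 0)]; exact smul _ _ (unit _ _)
  | h_add X Y hX hY => rw [embed_add]; exact add _ _ hX hY
  | h_std_basis i j c =>
    have h := smul c _ (unit (override C 0 i) (override C 0 j))
    rw [← embed_single, ← embed_smul, Matrix.smul_single, smul_eq_mul, mul_one] at h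
    have hr : ∀ o : Config {v // v ∈ C} d, (fun v : {v // v ∈ C} => override C 0 o v) = o :=
      fun o => funext fun v => by simp [override]
    rwa [hr, hr] at h

theorem embed_commute [NeZero d] {A B : Finset V} (h : Disjoint A B) (X : LocalOp A d)
    (Y : LocalOp B d) : Commute (embed A X) (embed B Y) := by
  refine embed_induction (P := fun Z => Commute Z (embed B Y)) (fun _ _ h h' => h.add_left h')
    (fun c _ h => h.smul_left c) (fun x y => ?_) X
  refine embed_induction (P := fun Z => Commute (unitOn A x y) Z) (fun _ _ h h' => h.add_right h')
    (fun c _ h => h.smul_right c) (fun x' y' => ?_) Y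
  rw [Commute, SemiconjBy, unitOn, unitOn, ← productOp_mul, ← productOp_mul]
  congr 1
  funext v
  have : v ∈ A → v ∉ B := fun hv => Finset.disjoint_left.mp h hv
  by_cases hA : v ∈ A <;> by_cases hB : v ∈ B <;> simp_all

theorem trace_embed_mul_embed [NeZero d] {A B : Finset V} (h : Disjoint A B) (X : LocalOp A d)
    (Y : LocalOp B d) :
    (d : ℂ) ^ Fintype.card V * (embed A X * embed B Y).trace =
      (embed A X).trace * (embed B Y).trace := by
  refine embed_induction (P := fun Z => (d : ℂ) ^ Fintype.card V * (Z * embed B Y).trace =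
      Z.trace * (embed B Y).trace) ?_ ?_ (fun x y => ?_) X
  · intro X Y hX hY
    simp only [add_mul, Matrix.trace_add, mul_add, hX, hY]
  · intro c X hX
    simp only [Matrix.smul_mul, Matrix.trace_smul, smul_eq_mul, mul_left_comm _ c, hX, mul_assoc]
  refine embed_induction (P := fun Z => (d : ℂ) ^ Fintype.card V * (unitOn A x y * Z).trace =
      (unitOn A x y).trace * Z.trace) ?_ ?_ (fun x' y' => ?_) Y
  · intro X Y hX hY
    simp only [mul_add, Matrix.trace_add, hX, hY]
  · intro c X hX
    simp only [Matrix.mul_smul, Matrix.trace_smul, smul_eq_mul, mul_left_comm _ c, hX]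
  refine trace_productOp_mul fun v => ?_
  have : v ∈ A → v ∉ B := fun hv => Finset.disjoint_left.mp h hv
  by_cases hA : v ∈ A <;> simp_all

theorem embed_mul (C : Finset V) (X Y : LocalOp C d) :
    embed C (X * Y) = embed C X * embed C Y := by
  ext s t
  have hinj : Function.Injective (override C s : Config {v // v ∈ C} d → Config V d) :=
    fun o o' h => funext fun v => by simpa [override] using congrFun h v.1
  rw [Matrix.mul_apply]
  simp only [embed, Matrix.of_apply, Matrix.mul_apply]
  rw [← Finset.sum_subset (Finset.subset_univ (Finset.univ.image (override C s))),
    Finset.sum_image fun _ _ _ _ h => hinj h]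
  · have h1 : ∀ o : Config {v // v ∈ C} d, (fun v : {v // v ∈ C} => override C s o v) = o :=
      fun o => funext fun v => by simp [override]
    have h2 : ∀ o : Config {v // v ∈ C} d, ∀ v ∉ C, override C s o v = s v :=
      fun o v hv => by simp [override, hv]
    have h3 : ∀ o : Config {v // v ∈ C} d,
        (∀ v ∉ C, override C s o v = t v) ↔ ∀ v ∉ C, s v = t v :=
      fun o => forall₂_congr fun v hv => by rw [h2 o v hv]
    have h4 : ∀ o : Config {v // v ∈ C} d, ∀ v ∉ C, s v = override C s o v :=
      fun o v hv => (h2 o v hv).symm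
    simp only [h1, h3, if_pos (h4 _)]
    split_ifs <;> simp
  · intro r _ hr
    rw [if_neg, zero_mul]
    intro h
    refine hr (Finset.mem_image.mpr ⟨fun v => r v, Finset.mem_univ _, funext fun v => ?_⟩)
    by_cases hv : v ∈ C <;> simp [override, hv, h]

/-! ### Partial traces -/

theorem tr_apply (C : Finset V) (X : Op V d) (p q : Config V d) :
    tr C X p q = if ∀ v ∈ C, p v = q v then (X * unitOn Cᶜ q p).trace else 0 := by
  rw [trace_mul_unitOn_compl]
  simp only [tr, embed, Matrix.of_apply, Finset.mem_compl, not_not, partialTrace]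
  rfl

theorem tr_compl_mul_tr_compl {A B : Finset V} (h : Disjoint A B) (X Y : Op V d)
    (p q : Config V d) :
    (tr Aᶜ X * tr Bᶜ Y) p q =
      if ∀ v ∉ A ∪ B, p v = q v then
        (X * unitOn A q p).trace * (Y * unitOn B q p).trace else 0 := by
  have hAB : ∀ v ∈ A, v ∉ B := fun v hv => Finset.disjoint_left.mp h hv
  -- The only intermediate configuration agrees with `p` off `A` and with `q` off `B`.
  rw [Matrix.mul_apply, Finset.sum_eq_single (fun v => if v ∈ A then q v else p v) _ (by simp)]
  · simp only [tr_apply, compl_compl, Finset.mem_compl, Finset.mem_union]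
    have h1 : ∀ v ∉ A, p v = if v ∈ A then q v else p v := by grind
    rw [if_pos h1]
    have h2 : (∀ v ∉ B, (if v ∈ A then q v else p v) = q v) ↔
        ∀ v, ¬ (v ∈ A ∨ v ∈ B) → p v = q v := by
      grind
    simp only [h2]
    split_ifs with h3
    · congr 3
      · exact unitOn_congr (fun v hv => by simp [hv]) fun v hv => rfl
      · exact unitOn_congr (fun v hv => rfl) fun v hv => if_neg fun h => hAB v h hv
    · simp
  · intro r _ hr
    simp only [tr_apply, compl_compl, Finset.mem_compl]
    by_cases h1 : ∀ v ∉ A, p v = r v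
    · by_cases h2 : ∀ v ∉ B, r v = q v
      · exact absurd (funext fun v => by grind) hr
      · simp [h2]
    · simp [h1]

end ProductOperators

section Spans

variable {n : Type*} [Fintype n] [DecidableEq n]

open scoped MatrixOrder Matrix.Norms.L2Operator in
/-- Positive semidefinite matrices span all matrices. -/
theorem posSemidef_induction {P : Matrix n n ℂ → Prop} (add : ∀ X Y, P X → P Y → P (X + Y))
    (smul : ∀ (c : ℂ) X, P X → P (c • X)) (psd : ∀ X, X.PosSemidef → P X)
    (X : Matrix n n ℂ) : P X := by
  have hX : X ∈ Submodule.span ℂ {a : Matrix n n ℂ | 0 ≤ a} := by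
    rw [CStarAlgebra.span_nonneg]; trivial
  induction hX using Submodule.span_induction with
  | mem x h => exact psd x (Matrix.nonneg_iff_posSemidef.mp h)
  | zero => exact psd 0 Matrix.PosSemidef.zero
  | add x y _ _ hx hy => exact add x y hx hy
  | smul c x _ hx => exact smul c x hx

theorem adjoint_unitaryChannel (U : Matrix.unitaryGroup n ℂ) (X : Matrix n n ℂ) :
    (unitaryChannel U).adjoint X =
      (U : Matrix n n ℂ).conjTranspose * X * (U : Matrix n n ℂ) := by
  ext i j
  have : (((unitaryChannel U).toLin (Matrix.single i j 1)).conjTranspose * X) =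
      U.1 * (Matrix.single j i 1 * (U.1.conjTranspose * X)) := by
    simp [unitaryChannel, Matrix.mul_assoc]
  rw [Channel.adjoint, Matrix.of_apply, this, Matrix.trace_mul_comm, Matrix.mul_assoc,
    Matrix.trace_mul_comm, Matrix.trace_mul_single]
  simp

end Spans

/-! ### Regions around a set of vertices -/

section RegionLemmas

variable {V : Type*} [Fintype V] [DecidableEq V] (G : SimpleGraph V) (A : Finset V)

theorem mem_neighborhood {r : ℕ} {n : V} :
    n ∈ neighborhood G A r ↔ n ∉ A ∧ ∃ m ∈ A, G.edist n m ≤ r := by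
  simp [neighborhood]

theorem mem_regABar {n : V} : n ∈ regABar G A ↔ ∃ m ∈ A, n = m ∨ G.Adj n m := by
  simp only [regABar, regA, Finset.mem_union, mem_neighborhood, Nat.cast_one,
    SimpleGraph.edist_le_one_iff_adj_or_eq]
  grind

theorem notMem_regFar {n : V} : n ∉ regFar G A ↔ ∃ m ∈ A, G.edist n m ≤ 2 := by
  simp only [regFar, regABar, regB, regA, Finset.mem_compl, not_not, Finset.mem_union,
    Finset.mem_sdiff, mem_neighborhood]
  constructor
  · rintro ((h | ⟨-, m, hm, h⟩) | ⟨⟨-, m, hm, h⟩, -⟩)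
    · exact ⟨n, h, by simp⟩
    · exact ⟨m, hm, h.trans (by norm_num)⟩
    · exact ⟨m, hm, by exact_mod_cast h⟩
  · rintro ⟨m, hm, h⟩
    have h2 : ∃ m ∈ A, G.edist n m ≤ (2 : ℕ) := ⟨m, hm, by exact_mod_cast h⟩
    by_cases hn : n ∈ A
    · exact .inl (.inl hn)
    · by_cases h1 : ∃ m ∈ A, G.edist n m ≤ (1 : ℕ)
      · exact .inl (.inr ⟨hn, h1⟩)
      · exact .inr ⟨⟨hn, h2⟩, fun h => h1 h.2⟩

theorem regFarBar_eq : regFarBar G A = (regABar G A)ᶜ := by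
  ext n
  simp only [regFarBar, regFar, regB, regABar, Finset.mem_union, Finset.mem_compl,
    Finset.mem_sdiff]
  by_cases h : n ∈ regA G A
  · simp [h]
  · by_cases hA : n ∈ A
    · have : n ∉ neighborhood G A 2 := fun h => ((mem_neighborhood G A).1 h).1 hA
      simp [hA, this]
    · simp only [h, hA]; tauto

theorem regA_union_regFarBar : regA G A ∪ regFarBar G A = Aᶜ := by
  rw [regFarBar_eq]
  ext n
  have : n ∈ regA G A → n ∉ A := fun h => ((mem_neighborhood G A).1 h).1
  simp only [regABar, Finset.mem_union, Finset.mem_compl]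
  tauto

theorem regABar_union_regB : regABar G A ∪ regB G A = (regFar G A)ᶜ := by
  rw [regFar, compl_compl]

theorem disjoint_regFar : Disjoint A (regFar G A) := by
  rw [Finset.disjoint_left]
  intro n h
  exact (notMem_regFar G A).2 ⟨n, h, by simp⟩

theorem regA_union_regB : regA G A ∪ regB G A = (A ∪ regFar G A)ᶜ := by
  ext n
  have h1 : n ∈ regA G A → n ∉ A := fun h => ((mem_neighborhood G A).1 h).1
  have h2 : n ∈ regB G A → n ∉ A :=
    fun h => ((mem_neighborhood G A).1 (Finset.mem_sdiff.1 h).1).1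
  simp only [regFar, regABar, Finset.mem_union, Finset.mem_compl]
  tauto

theorem disjoint_regABar_regFarBar : Disjoint (regABar G A) (regFarBar G A) := by
  rw [regFarBar_eq]; exact disjoint_compl_right

theorem disjoint_regABar_regABar_regFar : Disjoint (regABar G A) (regABar G (regFar G A)) := by
  rw [Finset.disjoint_left]
  intro n h h'
  obtain ⟨m, hm, h⟩ := (mem_regABar G A).1 h
  obtain ⟨m', hm', h'⟩ := (mem_regABar G _).1 h'
  refine (notMem_regFar G A).2 ⟨m, hm, ?_⟩ hm'
  rw [← SimpleGraph.edist_le_one_iff_adj_or_eq.trans or_comm] at h h'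
  calc G.edist m' m ≤ G.edist m' n + G.edist n m := G.edist_triangle
    _ ≤ 1 + 1 := add_le_add (by rwa [SimpleGraph.edist_comm]) h
    _ = 2 := by norm_num

/-- If `A` is admissible and nonempty then its far region is admissible as well, since its own far
region contains `A`. -/
theorem Admissible.regFar {G : SimpleGraph V} {A : Finset V} (hA : A.Nonempty) :
    Admissible G (regFar G A) := by
  obtain ⟨m, hm⟩ := hA
  refine ⟨m, ?_⟩
  by_contra h
  obtain ⟨n, hn, h⟩ := (notMem_regFar G _).1 h
  exact (notMem_regFar G A).2 ⟨m, hm, by rwa [SimpleGraph.edist_comm]⟩ hn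

end RegionLemmas

/-! ### Equivalence of the three notions of locality -/

section Equivalences

variable {V : Type*} [Fintype V] [DecidableEq V] {d : ℕ}

/-- An operator supported on `C` is supported on any larger region. -/
theorem exists_embed_eq_of_subset [NeZero d] {C C' : Finset V} (h : C ⊆ C') (X : LocalOp C d) :
    ∃ Y : LocalOp C' d, embed C X = embed C' Y := by
  refine embed_induction (P := fun Z => ∃ Y : LocalOp C' d, Z = embed C' Y) ?_ ?_ ?_ X
  · rintro _ _ ⟨Y, rfl⟩ ⟨Y', rfl⟩
    exact ⟨Y + Y', (embed_add _ _ _).symm⟩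
  · rintro c _ ⟨Y, rfl⟩
    exact ⟨c • Y, (embed_smul _ _ _).symm⟩
  · intro x y
    refine ⟨Matrix.of fun i j => unitOn C x y (override C' x i) (override C' x j), ?_⟩
    ext s t
    simp only [embed, Matrix.of_apply, unitOn_apply, override]
    grind

/-- `U` factorizes around `A` when expectation values of products of observables on `A` and `B`
factorize in the images of product operators on `Ā` and `B̄`. This is the bilinear condition that
locality preservation and simplicity have in common. -/
def Factorizes (G : SimpleGraph V) (U : Op V d) (A : Finset V) : Prop :=
  ∀ (ρ : LocalOp (regABar G A) d) (σ : LocalOp (regFarBar G A) d) (X : LocalOp A d)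
    (Y : LocalOp (regFar G A) d),
    (d : ℂ) ^ Fintype.card V * (U * (embed _ ρ * embed _ σ) * U.conjTranspose *
        (embed _ X * embed _ Y)).trace =
      (U * embed _ ρ * U.conjTranspose * embed _ X).trace *
        (U * embed _ σ * U.conjTranspose * embed _ Y).trace

variable {G : SimpleGraph V} {A : Finset V}

/-- Factorization only has to be tested on matrix units. -/
theorem factorizes_iff [NeZero d] (U : Op V d) :
    Factorizes G U A ↔ ∀ x y p q : Config V d,
      (d : ℂ) ^ Fintype.card V * (U * Matrix.single x y 1 * U.conjTranspose *
        unitOn (A ∪ regFar G A) q p).trace =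
      (U * unitOn (regABar G A) x y * U.conjTranspose * unitOn A q p).trace *
        (U * unitOn (regFarBar G A) x y * U.conjTranspose * unitOn (regFar G A) q p).trace := by
  have hA := disjoint_regFar G A
  have hAbar := disjoint_regABar_regFarBar G A
  have huniv : regABar G A ∪ regFarBar G A = Finset.univ := by
    rw [regFarBar_eq, Finset.union_compl]
  constructor
  · intro h x y p q
    have := h (Matrix.single (fun v => x v) (fun v => y v) 1)
      (Matrix.single (fun v => x v) (fun v => y v) 1)
      (Matrix.single (fun v => q v) (fun v => p v) 1)
      (Matrix.single (fun v => q v) (fun v => p v) 1)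
    simp only [embed_single] at this
    rwa [← unitOn_union hA, ← unitOn_union hAbar, huniv, unitOn_univ] at this
  · intro h ρ σ X Y
    refine embed_induction (P := fun R => (d : ℂ) ^ Fintype.card V *
        (U * (R * embed _ σ) * U.conjTranspose * (embed _ X * embed _ Y)).trace =
      (U * R * U.conjTranspose * embed _ X).trace *
        (U * embed _ σ * U.conjTranspose * embed _ Y).trace) ?_ ?_ (fun x y => ?_) ρ
    · intro R R' h h'
      simp only [mul_add, add_mul, Matrix.trace_add, h, h']
    · intro c R h
      simp only [Matrix.smul_mul, Matrix.mul_smul, Matrix.trace_smul, smul_eq_mul,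
        mul_left_comm _ c, h, mul_assoc c]
    refine embed_induction (P := fun S => (d : ℂ) ^ Fintype.card V *
        (U * (unitOn (regABar G A) x y * S) * U.conjTranspose * (embed _ X * embed _ Y)).trace =
      (U * unitOn (regABar G A) x y * U.conjTranspose * embed _ X).trace *
        (U * S * U.conjTranspose * embed _ Y).trace) ?_ ?_ (fun x' y' => ?_) σ
    · intro S S' h h'
      simp only [mul_add, add_mul, Matrix.trace_add, h, h']
    · intro c S h
      simp only [Matrix.smul_mul, Matrix.mul_smul, Matrix.trace_smul, smul_eq_mul,
        mul_left_comm _ c, h]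
    refine embed_induction (P := fun R => (d : ℂ) ^ Fintype.card V *
        (U * (unitOn (regABar G A) x y * unitOn (regFarBar G A) x' y') * U.conjTranspose *
          (R * embed _ Y)).trace =
      (U * unitOn (regABar G A) x y * U.conjTranspose * R).trace *
        (U * unitOn (regFarBar G A) x' y' * U.conjTranspose * embed _ Y).trace)
        ?_ ?_ (fun q p => ?_) X
    · intro R R' h h'
      simp only [mul_add, add_mul, Matrix.trace_add, h, h']
    · intro c R h
      simp only [Matrix.smul_mul, Matrix.mul_smul, Matrix.trace_smul, smul_eq_mul,
        mul_left_comm _ c, h, mul_assoc c]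
    refine embed_induction (P := fun S => (d : ℂ) ^ Fintype.card V *
        (U * (unitOn (regABar G A) x y * unitOn (regFarBar G A) x' y') * U.conjTranspose *
          (unitOn A q p * S)).trace =
      (U * unitOn (regABar G A) x y * U.conjTranspose * unitOn A q p).trace *
        (U * unitOn (regFarBar G A) x' y' * U.conjTranspose * S).trace) ?_ ?_ (fun q' p' => ?_) Y
    · intro S S' h h'
      simp only [mul_add, Matrix.trace_add, h, h']
    · intro c S h
      simp only [Matrix.mul_smul, Matrix.trace_smul, smul_eq_mul, mul_left_comm _ c, h]
    -- A pair of matrix units on disjoint regions is labelled by a single pair of configurations.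
    have glue : ∀ {C C' : Finset V}, Disjoint C C' → ∀ x y x' y' : Config V d, ∃ x'' y'',
        unitOn C x y = unitOn C x'' y'' ∧ unitOn C' x' y' = unitOn C' x'' y'' := by
      intro C C' hC x y x' y'
      have hC' : ∀ v ∈ C', v ∉ C := fun v h h' => Finset.disjoint_left.mp hC h' h
      exact ⟨fun v => if v ∈ C then x v else x' v, fun v => if v ∈ C then y v else y' v,
        unitOn_congr (fun v hv => (if_pos hv).symm) (fun v hv => (if_pos hv).symm),
        unitOn_congr (fun v hv => (if_neg (hC' v hv)).symm)
          (fun v hv => (if_neg (hC' v hv)).symm)⟩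
    obtain ⟨x, y, h1, h2⟩ := glue hAbar x y x' y'
    obtain ⟨q, p, h3, h4⟩ := glue hA q p q' p'
    rw [h1, h2, h3, h4, ← unitOn_union hA, ← unitOn_union hAbar, huniv, unitOn_univ]
    exact h x y p q

theorem trace_conj_mul {n : Type*} [Fintype n] (U R Z : Matrix n n ℂ) :
    (U * R * U.conjTranspose * Z).trace = (R * (U.conjTranspose * Z * U)).trace := by
  rw [Matrix.mul_assoc, Matrix.mul_assoc, Matrix.trace_mul_comm]
  simp only [Matrix.mul_assoc]

theorem exists_eq_embed_univ (Z : Op V d) : ∃ Y : LocalOp Finset.univ d, Z = embed _ Y := by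
  refine ⟨Matrix.of fun s t => Z (fun v => s ⟨v, Finset.mem_univ v⟩)
    (fun v => t ⟨v, Finset.mem_univ v⟩), ?_⟩
  ext s t
  simp [embed_apply]

/-- The far region `B` lies at distance at least two from `Ā`, so that causality preservation
also confines the evolution of the observables on `B`, to `B̄`. -/
theorem IsCPQC.exists_regFarBar [NeZero d] {E : Channel (Config V d)} (h : IsCPQC G E)
    (Y : LocalOp (regFar G A) d) :
    ∃ Y' : LocalOp (regFarBar G A) d, E.adjoint (embed _ Y) = embed _ Y' := by
  rcases A.eq_empty_or_nonempty with rfl | hne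
  · have : regFarBar G (∅ : Finset V) = Finset.univ := by
      rw [regFarBar_eq, Finset.compl_eq_univ_iff, Finset.eq_empty_iff_forall_notMem]
      simp [mem_regABar]
    rw [this]
    exact exists_eq_embed_univ _
  · obtain ⟨Y', hY⟩ := h _ (Admissible.regFar (G := G) hne) Y
    obtain ⟨Y'', hY'⟩ := exists_embed_eq_of_subset (C' := regFarBar G A) (by
      rw [regFarBar_eq, Finset.subset_compl_iff_disjoint_left]
      exact disjoint_regABar_regABar_regFar G A) Y'
    exact ⟨Y'', hY.trans hY'⟩

/-- In the Heisenberg picture the observables on `A` and on `B` have disjoint supports contained in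
`Ā` and `B̄`, so that the trace against a product operator factorizes. -/
theorem IsCPQC.factorizes [NeZero d] {U : Matrix.unitaryGroup (Config V d) ℂ}
    (h : IsCPQC G (unitaryChannel U)) (hA : Admissible G A) : Factorizes G (U : Op V d) A := by
  intro ρ σ X Y
  obtain ⟨X', hX⟩ := h A hA X
  obtain ⟨Y', hY⟩ := h.exists_regFarBar Y
  rw [adjoint_unitaryChannel] at hX hY
  have hAbar := disjoint_regABar_regFarBar G A
  have hU : (U : Op V d) * (U : Op V d).conjTranspose = 1 := Matrix.mem_unitaryGroup_iff.mp U.2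
  have hmul : U.1.conjTranspose * (embed A X * embed (regFar G A) Y) * U.1 =
      embed (regABar G A) X' * embed (regFarBar G A) Y' := by
    rw [← hX, ← hY]
    calc _ = U.1.conjTranspose * embed A X * (U.1 * U.1.conjTranspose) *
          embed (regFar G A) Y * U.1 := by rw [hU, Matrix.mul_one]; simp only [Matrix.mul_assoc]
      _ = _ := by simp only [Matrix.mul_assoc]
  have hcomm : embed _ ρ * embed _ σ * (embed _ X' * embed _ Y') =
      embed _ (ρ * X') * embed _ (σ * Y') := by
    rw [embed_mul, embed_mul, Matrix.mul_assoc, ← Matrix.mul_assoc (embed _ σ),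
      (embed_commute hAbar X' σ).eq.symm]
    simp only [Matrix.mul_assoc]
  rw [trace_conj_mul, trace_conj_mul, trace_conj_mul, hX, hY, hmul, hcomm,
    trace_embed_mul_embed hAbar, embed_mul, embed_mul]

/-- Testing with the identity on `B` shows that the image of an observable on `A` has the matrix
elements of an operator on `Ā`. -/
theorem isCPQC_of_factorizes [NeZero d] {U : Matrix.unitaryGroup (Config V d) ℂ}
    (h : ∀ A, Admissible G A → Factorizes G (U : Op V d) A) : IsCPQC G (unitaryChannel U) := by
  intro A hA X
  rw [adjoint_unitaryChannel]
  set Z := U.1.conjTranspose * embed A X * U.1 with hZ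
  have hU : (U : Op V d).conjTranspose * (U : Op V d) = 1 := Matrix.UnitaryGroup.star_mul_self U
  have cyc : ∀ R : Op V d, (U.1 * R * U.1.conjTranspose).trace = R.trace := by
    intro R
    rw [Matrix.trace_mul_comm, ← Matrix.mul_assoc, hU, Matrix.one_mul]
  have hd : (d : ℂ) ≠ 0 := Nat.cast_ne_zero.mpr (NeZero.ne d)
  have huniv : regABar G A ∪ regFarBar G A = Finset.univ := by
    rw [regFarBar_eq, Finset.union_compl]
  have key : ∀ s t : Config V d, (d : ℂ) ^ Fintype.card V * Z s t =
      (unitOn (regABar G A) t s * Z).trace * (unitOn (regFarBar G A) t s).trace := by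
    intro s t
    have := h A hA (Matrix.single (fun v => t v) (fun v => s v) 1)
      (Matrix.single (fun v => t v) (fun v => s v) 1) X 1
    rw [embed_one, Matrix.mul_one, Matrix.mul_one, trace_conj_mul, trace_conj_mul, cyc,
      embed_single, embed_single, ← unitOn_union (disjoint_regABar_regFarBar G A), huniv,
      unitOn_univ] at this
    rw [← this, Matrix.trace_single_mul, one_smul]
  have htr : ∀ s t : Config V d, (unitOn (regFarBar G A) t s).trace =
      if ∀ v ∉ regABar G A, s v = t v then (d : ℂ) ^ (regABar G A).card else 0 := by
    intro s t
    have hv : ∀ v, (if v ∈ regFarBar G A then Matrix.single (t v) (s v) (1 : ℂ) else 1).trace =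
        if v ∉ regABar G A → s v = t v then (if v ∈ regABar G A then (d : ℂ) else 1) else 0 := by
      intro v
      rw [regFarBar_eq]
      by_cases hv : v ∈ regABar G A
      · simp [hv]
      · by_cases hst : s v = t v
        · simp [hv, hst]
        · simp [hv, hst, Matrix.trace_single_eq_of_ne _ _ _ (Ne.symm hst)]
    rw [unitOn, trace_productOp, Finset.prod_congr rfl fun v _ => hv v, Finset.prod_ite_zero]
    simp
  refine ⟨Matrix.of fun i j => ((d : ℂ) ^ Fintype.card V)⁻¹ *
    ((embed _ (Matrix.single j i 1) * Z).trace * (d : ℂ) ^ (regABar G A).card), ?_⟩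
  ext s t
  have hk := key s t
  rw [htr] at hk
  rw [← embed_single] at hk
  refine mul_left_cancel₀ (pow_ne_zero (Fintype.card V) hd) (hk.trans ?_)
  rw [embed_apply, Matrix.of_apply]
  split_ifs
  · rw [mul_inv_cancel_left₀ (pow_ne_zero _ hd)]
  · simp

theorem isLPQC_iff_factorizes [NeZero d] {U : Matrix.unitaryGroup (Config V d) ℂ} :
    IsLPQC G (unitaryChannel U) ↔ ∀ A, Admissible G A → Factorizes G (U : Op V d) A := by
  have hd : (d : ℂ) ≠ 0 := Nat.cast_ne_zero.mpr (NeZero.ne d)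
  refine forall₂_congr fun A _ => ?_
  have hA := disjoint_regFar G A
  have hE : ∀ X, (unitaryChannel U).toLin X = U.1 * X * U.1.conjTranspose := fun _ => rfl
  constructor
  · intro h
    have hpsd : ∀ (ρ : LocalOp (regABar G A) d) (σ : LocalOp (regFarBar G A) d),
        ρ.PosSemidef → σ.PosSemidef → ∀ p q : Config V d, (∀ v ∉ A ∪ regFar G A, p v = q v) →
        (d : ℂ) ^ Fintype.card V * (U.1 * (embed _ ρ * embed _ σ) * U.1.conjTranspose *
            unitOn (A ∪ regFar G A) q p).trace =
          (U.1 * embed _ ρ * U.1.conjTranspose * unitOn A q p).trace *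
            (U.1 * embed _ σ * U.1.conjTranspose * unitOn (regFar G A) q p).trace := by
      intro ρ σ hρ hσ p q hpq
      have := congrFun (congrFun (h ρ σ hρ hσ) p) q
      rw [regA_union_regFarBar, regABar_union_regB, regA_union_regB, Matrix.smul_apply,
        tr_compl_mul_tr_compl hA, tr_apply, compl_compl, if_pos hpq, if_pos (by simpa using hpq),
        smul_eq_mul, hE, hE, hE] at this
      rw [this]
      field_simp
    have hall : ∀ (ρ : LocalOp (regABar G A) d) (σ : LocalOp (regFarBar G A) d),
        ∀ p q : Config V d, (∀ v ∉ A ∪ regFar G A, p v = q v) →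
        (d : ℂ) ^ Fintype.card V * (U.1 * (embed _ ρ * embed _ σ) * U.1.conjTranspose *
            unitOn (A ∪ regFar G A) q p).trace =
          (U.1 * embed _ ρ * U.1.conjTranspose * unitOn A q p).trace *
            (U.1 * embed _ σ * U.1.conjTranspose * unitOn (regFar G A) q p).trace := by
      intro ρ σ p q hpq
      induction ρ using posSemidef_induction with
      | add R R' h h' => simp only [embed_add, mul_add, add_mul, Matrix.trace_add, h, h']
      | smul c R h =>
        simp only [embed_smul, Matrix.smul_mul, Matrix.mul_smul, Matrix.trace_smul, smul_eq_mul,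
          mul_left_comm _ c, h, mul_assoc c]
      | psd ρ hρ =>
        induction σ using posSemidef_induction with
        | add R R' h h' => simp only [embed_add, mul_add, add_mul, Matrix.trace_add, h, h']
        | smul c R h =>
          simp only [embed_smul, Matrix.smul_mul, Matrix.mul_smul, Matrix.trace_smul, smul_eq_mul,
            mul_left_comm _ c, h]
        | psd σ hσ => exact hpsd ρ σ hρ hσ p q hpq
    rw [factorizes_iff]
    intro x y p q
    have := hall (Matrix.single (fun v => x v) (fun v => y v) 1)
      (Matrix.single (fun v => x v) (fun v => y v) 1)
      p (fun v => if v ∈ A ∪ regFar G A then q v else p v)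
      (fun v hv => (if_neg hv).symm)
    rw [embed_single, embed_single, ← unitOn_union (disjoint_regABar_regFarBar G A),
      regFarBar_eq, Finset.union_compl, unitOn_univ, ← regFarBar_eq] at this
    have hq : ∀ C ⊆ A ∪ regFar G A,
        unitOn C (fun v => if v ∈ A ∪ regFar G A then q v else p v) p = unitOn C q p :=
      fun C hC => unitOn_congr (fun v hv => if_pos (hC hv)) fun _ _ => rfl
    rwa [hq _ subset_rfl, hq _ Finset.subset_union_left, hq _ Finset.subset_union_right] at this
  · intro h ρ σ _ _
    ext p q
    rw [regA_union_regFarBar, regABar_union_regB, regA_union_regB, Matrix.smul_apply,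
      tr_compl_mul_tr_compl hA, tr_apply, compl_compl, smul_eq_mul, hE, hE, hE]
    simp only [Finset.mem_compl]
    split_ifs with hpq
    · have := h ρ σ (Matrix.single (fun v => q v) (fun v => p v) 1)
        (Matrix.single (fun v => q v) (fun v => p v) 1)
      rw [embed_single, embed_single, ← unitOn_union hA] at this
      rw [← this]
      field_simp
    · simp

/-- A double layer is a trace of `U` and its adjoint against matrix units of the uncontracted
regions. -/
theorem doubleLayer_eq_trace {D : ℕ} (T : PEPO G d D) (O I : Finset V) (p q x y : Config V d) :
    PEPO.doubleLayer T O I p q x y =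
      (T.contract * unitOn Iᶜ x y * T.contract.conjTranspose * unitOn Oᶜ q p).trace := by
  rw [trace_mul_unitOn_compl, PEPO.doubleLayer]
  refine Finset.sum_congr rfl fun o _ => ?_
  rw [unitOn_compl, Matrix.mul_sum, Matrix.sum_mul, Matrix.sum_apply]
  refine Finset.sum_congr rfl fun i _ => ?_
  rw [Matrix.mul_apply, Finset.sum_eq_single (override I y i)]
  · simp
  · intro r _ hr
    rw [Matrix.mul_single_apply_of_ne _ _ _ _ _ hr, zero_mul]
  · simp

theorem isSimple_iff_factorizes [NeZero d] {D : ℕ} (T : PEPO G d D) :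
    T.IsSimple ↔ ∀ A, Admissible G A → Factorizes G T.contract A := by
  have hd : (d : ℂ) ≠ 0 := Nat.cast_ne_zero.mpr (NeZero.ne d)
  refine forall₂_congr fun A _ => ?_
  rw [factorizes_iff]
  have hcard : (d : ℂ) ^ Fintype.card V =
      (d : ℂ) ^ (regABar G A).card * (d : ℂ) ^ (regFarBar G A).card := by
    rw [← pow_add, regFarBar_eq, Finset.card_add_card_compl]
  have hset : (regFarBar G A)ᶜ = regABar G A := by rw [regFarBar_eq, compl_compl]
  simp only [doubleLayer_eq_trace, regA_union_regB, regA_union_regFarBar, regABar_union_regB,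
    compl_compl, ← regFarBar_eq, hset, Finset.compl_empty, unitOn_univ]
  constructor
  · intro h x y p q
    rw [h p q x y, hcard]
    field_simp
  · intro h p q x y
    have := h x y p q
    rw [hcard] at this
    field_simp
    linear_combination this

end Equivalences

/-! ### Contractions with an arbitrary bond space -/

section Networks

variable {V : Type*} [Fintype V] [DecidableEq V] {d : ℕ} {G : SimpleGraph V}

open Classical in
/-- The contraction of a network whose bonds carry indices in an arbitrary finite type `K`. -/
noncomputable def contractWith {K : Type*} [Fintype K]
    (T : (n : V) → (G.incidenceSet n → K) → Fin d → Fin d → ℂ) : Op V d :=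
  Matrix.of fun s t => ∑ k : G.edgeSet → K, ∏ n : V, T n (fun e => k ⟨e.1, e.2.1⟩) (s n) (t n)

/-- A network with bonds in `K` can be padded with zeros to any bond dimension `D ≥ |K|`. -/
theorem exists_contract_eq_contractWith {K : Type*} [Fintype K] [Nonempty K] {D : ℕ}
    (hD : Fintype.card K ≤ D) (T : (n : V) → (G.incidenceSet n → K) → Fin d → Fin d → ℂ) :
    ∃ T' : PEPO G d D, T'.contract = contractWith T := by
  classical
  obtain ⟨ι⟩ : Nonempty (K ↪ Fin D) := Function.Embedding.nonempty_of_card_le (by simpa using hD)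
  refine ⟨fun n k s t => if ∀ e, k e ∈ Set.range ι then
    T n (fun e => Function.invFun ι (k e)) s t else 0, ?_⟩
  ext s t
  simp only [PEPO.contract, contractWith, Matrix.of_apply]
  symm
  refine Fintype.sum_of_injective (fun k e => ι (k e))
    (fun k k' h => funext fun e => ι.injective (congrFun h e)) _ _ ?_ ?_
  · intro k hk
    obtain ⟨e, he⟩ : ∃ e, k e ∉ Set.range ι := by
      by_contra! h
      choose k' hk' using h
      exact hk ⟨k', funext hk'⟩
    obtain ⟨n, hn⟩ : ∃ n, n ∈ e.1 := ⟨_, Sym2.out_fst_mem e.1⟩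
    refine Finset.prod_eq_zero (Finset.mem_univ n) (if_neg fun h => he ?_)
    exact h ⟨e.1, e.2, hn⟩
  · intro k
    simp [Function.leftInverse_invFun ι.injective _]

/-- A nonzero scalar can be absorbed in one of the tensors. -/
theorem exists_contractWith_eq_smul [Nonempty V] {K : Type*} [Fintype K]
    (T : (n : V) → (G.incidenceSet n → K) → Fin d → Fin d → ℂ) (c : ℂ) :
    ∃ T' : (n : V) → (G.incidenceSet n → K) → Fin d → Fin d → ℂ,
      contractWith T' = c • contractWith T := by
  classical
  obtain ⟨v⟩ := ‹Nonempty V›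
  refine ⟨fun n k s t => (if n = v then c else 1) * T n k s t, ?_⟩
  ext s t
  simp only [contractWith, Matrix.of_apply, Matrix.smul_apply, smul_eq_mul,
    Finset.prod_mul_distrib, Finset.mul_sum]
  simp

/-- On a connected graph every operator is a network: each bond carries a global output and a
global input configuration, each tensor forces its bonds to agree with each other and with its own
physical indices, and one of the tensors supplies the matrix element. -/
theorem exists_contractWith_eq_of_preconnected [Nonempty V] (hG : G.Preconnected) (X : Op V d) :
    ∃ T : (n : V) → (G.incidenceSet n → Config V d × Config V d) → Fin d → Fin d → ℂ,
      contractWith T = X := by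
  classical
  obtain ⟨v₀⟩ := ‹Nonempty V›
  refine ⟨fun n k s t => ∑ c : Config V d × Config V d,
    if (∀ e, k e = c) ∧ c.1 n = s ∧ c.2 n = t then (if n = v₀ then X c.1 c.2 else 1) else 0, ?_⟩
  ext s t
  simp only [contractWith, Matrix.of_apply, Finset.prod_univ_sum, Fintype.piFinset_univ]
  -- Only the constant families with value `(s, t)` contribute.
  have hzero : ∀ (k : G.edgeSet → Config V d × Config V d) (c : V → Config V d × Config V d),
      (k ≠ (fun _ => (s, t)) ∨ c ≠ (fun _ => (s, t))) →
      ∏ n, (if (∀ e : G.incidenceSet n, k ⟨e.1, e.2.1⟩ = c n) ∧ (c n).1 n = s n ∧ (c n).2 n = t n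
        then (if n = v₀ then X (c n).1 (c n).2 else 1) else 0) = 0 := by
    intro k c hkc
    rw [Finset.prod_ite_zero, if_neg]
    intro h
    have hadj : ∀ v w, G.Adj v w → c v = c w := fun v w hvw =>
      ((h v (Finset.mem_univ v)).1 ⟨s(v, w), hvw, Sym2.mem_mk_left v w⟩).symm.trans
        ((h w (Finset.mem_univ w)).1 ⟨s(v, w), hvw, Sym2.mem_mk_right v w⟩)
    have hc : ∀ v w, c v = c w := by
      intro v w
      obtain ⟨p⟩ := hG v w
      induction p with
      | nil => rfl
      | cons h _ ih => exact (hadj _ _ h).trans ih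
    have hc' : c = fun _ => (s, t) := by
      funext v
      refine Prod.ext (funext fun w => ?_) (funext fun w => ?_)
      · rw [hc v w]; exact (h w (Finset.mem_univ w)).2.1
      · rw [hc v w]; exact (h w (Finset.mem_univ w)).2.2
    refine hkc.elim (fun hk => hk (funext fun e => ?_)) fun h => h hc'
    have := (h _ (Finset.mem_univ (Quot.out e.1).1)).1 ⟨e.1, e.2, Sym2.out_fst_mem e.1⟩
    rw [hc'] at this
    exact this
  refine (Finset.sum_eq_single (fun _ => (s, t)) ?_ ?_).trans
    ((Finset.sum_eq_single (fun _ => (s, t)) ?_ ?_).trans ?_)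
  · intro k _ hk
    exact Finset.sum_eq_zero fun c _ => hzero k c (.inl hk)
  · exact fun h => absurd (Finset.mem_univ _) h
  · intro c _ hc
    exact hzero (fun _ => (s, t)) c (.inr hc)
  · exact fun h => absurd (Finset.mem_univ _) h
  · simp

/-! ### Products of operators supported on neighborhoods -/

/-- The single-site factor at `w` of a product of matrix units labelled by `α` on the region `C`. -/
def siteFactor {C : Finset V} (α : {w // w ∈ C} → Fin d × Fin d) (w : V) :
    Matrix (Fin d) (Fin d) ℂ :=
  if h : w ∈ C then Matrix.single (α ⟨w, h⟩).1 (α ⟨w, h⟩).2 1 else 1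

theorem embed_eq_sum (C : Finset V) (X : LocalOp C d) :
    embed C X = ∑ α : {w // w ∈ C} → Fin d × Fin d,
      X (fun w => (α w).1) (fun w => (α w).2) • productOp (siteFactor α) := by
  ext s t
  have h : ∀ α : {w // w ∈ C} → Fin d × Fin d, productOp (siteFactor α) s t =
      if (∀ w, α w = (s w, t w)) ∧ ∀ w ∉ C, s w = t w then 1 else 0 := by
    intro α
    have hw : ∀ w, siteFactor α w (s w) (t w) =
        if (∀ h : w ∈ C, α ⟨w, h⟩ = (s w, t w)) ∧ (w ∉ C → s w = t w) then 1 else 0 := by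
      intro w
      by_cases h : w ∈ C
      · simp [siteFactor, h, Matrix.single_apply, Prod.ext_iff]
      · simp [siteFactor, h, Matrix.one_apply]
    rw [productOp, Matrix.of_apply, Finset.prod_congr rfl fun w _ => hw w, Finset.prod_ite_zero]
    simp [forall_and]
  rw [Matrix.sum_apply, Finset.sum_eq_single (fun w : {w // w ∈ C} => (s w.1, t w.1)) _ (by simp)]
  · simp [embed_apply, h]
  · intro α _ hα
    rw [Matrix.smul_apply, h, if_neg, smul_zero]
    exact fun h => hα (funext h.1)

/-- Distributivity for an ordered noncommutative product of sums. -/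
theorem prod_ofFn_sum {R : Type*} [Ring R] {N : ℕ} (e : Fin N ≃ V) {ι : V → Type*}
    [∀ v, Fintype (ι v)] (f : ∀ v, ι v → R) :
    (List.ofFn fun i => ∑ a, f (e i) a).prod =
      ∑ g : ∀ v, ι v, (List.ofFn fun i => f (e i) (g (e i))).prod := by
  have h := (MultilinearMap.mkPiAlgebraFin ℤ N R).map_sum fun i a => f (e i) a
  simp only [MultilinearMap.mkPiAlgebraFin_apply] at h
  rw [h]
  refine Fintype.sum_equiv (Equiv.piCongrLeft ι e) _ _ fun g => ?_
  simp only [Equiv.piCongrLeft_apply_apply]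

theorem prod_ofFn_smul_productOp {N : ℕ} (e : Fin N ≃ V) (c : V → ℂ)
    (m : V → V → Matrix (Fin d) (Fin d) ℂ) :
    (List.ofFn fun i => c (e i) • productOp (m (e i))).prod =
      (∏ v, c v) • productOp fun w => (List.ofFn fun i => m (e i) w).prod := by
  have h := (MultilinearMap.mkPiAlgebraFin ℂ N (Op V d)).map_smul_univ (fun i => c (e i))
    fun i => productOp (m (e i))
  simp only [MultilinearMap.mkPiAlgebraFin_apply] at h
  rw [h, e.prod_comp]
  congr 1
  have h2 := map_list_prod (productOpHom V d) (List.ofFn fun i => m (e i))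
  rw [List.map_ofFn] at h2
  refine h2.symm.trans (congrArg productOp (funext fun w => ?_))
  have h3 := map_list_prod (Pi.evalMonoidHom (fun _ : V => Matrix (Fin d) (Fin d) ℂ) w)
    (List.ofFn fun i => m (e i))
  rw [List.map_ofFn] at h3
  exact h3

/-- The legs of the local operator at `u`, one for each `w` in its closed neighborhood: the leg at
`u` itself is the value `a u`, and the leg at a neighbor `w` is carried by the bond `s(u, w)`, each
bond carrying two legs that are told apart by the order of its endpoints. -/
def legs {K : Type*} {N : ℕ} (e : Fin N ≃ V) (a : V → K) {E : Set (Sym2 V)}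
    [DecidablePred (· ∈ E)] (k : E → Bool → K) (u w : V) : K :=
  if h : s(u, w) ∈ E then k ⟨s(u, w), h⟩ (decide (e.symm u < e.symm w)) else a u

/-- A value on each vertex and two on each bond amount to one value on each leg. -/
theorem bijective_legs {K : Type*} [DecidableRel G.Adj] {N : ℕ} (e : Fin N ≃ V) :
    Function.Bijective fun (x : (G.edgeSet → Bool → K) × (V → K)) (u : V)
      (w : {w // w ∈ regABar G {u}}) => legs e x.2 x.1 u w := by
  have hmem : ∀ u w, w ∈ regABar G {u} ↔ w = u ∨ G.Adj u w := by
    simp [mem_regABar, SimpleGraph.adj_comm]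
  constructor
  · rintro ⟨k, a⟩ ⟨k', a'⟩ h
    have h' : ∀ u w, w = u ∨ G.Adj u w → legs e a k u w = legs e a' k' u w :=
      fun u w huw => congrFun (congrFun h u) ⟨w, (hmem u w).2 huw⟩
    refine Prod.ext (funext fun ⟨x, hx⟩ => funext fun b => ?_) (funext fun u => ?_)
    · induction x using Sym2.ind with
      | _ u w =>
        have huw : G.Adj u w := hx
        have h1 := h' u w (.inr huw)
        have h2 := h' w u (.inr huw.symm)
        have hs : s(w, u) = s(u, w) := Sym2.eq_swap
        simp only [legs, hs, hx, dite_true] at h1 h2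
        have hne : e.symm u ≠ e.symm w := fun h => huw.ne (e.symm.injective h)
        rcases lt_or_gt_of_ne hne with hlt | hlt
        · rw [decide_eq_true hlt] at h1
          rw [decide_eq_false hlt.not_gt] at h2
          cases b
          · exact h2
          · exact h1
        · rw [decide_eq_false hlt.not_gt] at h1
          rw [decide_eq_true hlt] at h2
          cases b
          · exact h1
          · exact h2
    · simpa [legs] using h' u u (.inl rfl)
  · intro α
    have hk : ∀ (x : G.edgeSet) (b : Bool), ∃ c, ∀ u w (h : w ∈ regABar G {u}), s(u, w) = x.1 →
        b = decide (e.symm u < e.symm w) → c = α u ⟨w, h⟩ := by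
      rintro ⟨x, hx⟩ b
      induction x using Sym2.ind with
      | _ u w =>
        have huw : G.Adj u w := hx
        have hne : e.symm u ≠ e.symm w := fun h => huw.ne (e.symm.injective h)
        by_cases hb : b = decide (e.symm u < e.symm w)
        · refine ⟨α u ⟨w, (hmem u w).2 (.inr huw)⟩, fun u' w' h hs hb' => ?_⟩
          rcases Sym2.eq_iff.1 hs with ⟨rfl, rfl⟩ | ⟨rfl, rfl⟩
          · rfl
          · rw [hb'] at hb
            simp only [decide_eq_decide] at hb
            omega
        · refine ⟨α w ⟨u, (hmem w u).2 (.inr huw.symm)⟩, fun u' w' h hs hb' => ?_⟩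
          rcases Sym2.eq_iff.1 hs with ⟨rfl, rfl⟩ | ⟨rfl, rfl⟩
          · exact absurd hb' hb
          · rfl
    choose k hk using hk
    refine ⟨(k, fun u => α u ⟨u, (hmem u u).2 (.inl rfl)⟩), funext fun u => funext fun ⟨w, hw⟩ => ?_⟩
    simp only [legs]
    split_ifs with h
    · exact hk _ _ u w hw rfl rfl
    · obtain rfl : w = u := ((hmem u w).1 hw).resolve_right h
      rfl

/-- A product of local operators, one supported on each closed neighborhood and each depending on
the output index of its center, is a network with bonds in `Bool → Fin d × Fin d`: a bond carries
the matrix unit by which each of its endpoints acts on the other one. -/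
theorem exists_contractWith_eq_prod {N : ℕ} (e : Fin N ≃ V)
    (y : (v : V) → Fin d → LocalOp (regABar G {v}) d) (t₀ : Config V d) :
    ∃ T : (n : V) → (G.incidenceSet n → Bool → Fin d × Fin d) → Fin d → Fin d → ℂ,
      ∀ s t, contractWith T s t =
        (List.ofFn fun i => embed _ (y (e i) (s (e i)))).prod t₀ t := by
  classical
  have hmem : ∀ u w, w ∈ regABar G {u} ↔ w = u ∨ G.Adj u w := by
    simp [mem_regABar, SimpleGraph.adj_comm]
  refine ⟨fun n k s t => ∑ p : Fin d × Fin d,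
    y n s (fun w => (legs e (fun _ => p) k n w).1) (fun w => (legs e (fun _ => p) k n w).2) *
      (List.ofFn fun i => siteFactor (C := regABar G {e i})
        (fun w => legs e (fun _ => p) k (e i) w) n).prod (t₀ n) t, fun s t => ?_⟩
  simp only [embed_eq_sum]
  rw [prod_ofFn_sum e fun v (α : {w // w ∈ regABar G {v}} → Fin d × Fin d) =>
    y v (s v) (fun w => (α w).1) (fun w => (α w).2) • productOp (siteFactor α)]
  simp only [contractWith, Matrix.of_apply, Finset.prod_univ_sum, Fintype.piFinset_univ]
  rw [Matrix.sum_apply, ← Fintype.sum_prod_type']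
  refine Fintype.sum_bijective _ (bijective_legs e) _ _ fun ⟨k, a⟩ => ?_
  have hprod := prod_ofFn_smul_productOp e
    (fun v => y v (s v) (fun w => (legs e a k v w).1) (fun w => (legs e a k v w).2))
    fun v => siteFactor (C := regABar G {v}) (fun w => legs e a k v w)
  refine Eq.trans ?_ (congrFun (congrFun hprod t₀) t).symm
  simp only [Matrix.smul_apply, productOp, Matrix.of_apply, smul_eq_mul,
    ← Finset.prod_mul_distrib]
  refine Finset.prod_congr rfl fun n _ => ?_
  -- Near `n`, the legs only involve the bonds at `n` and the value `a n`.
  have hlegs : ∀ u w, w ∈ regABar G {u} → (u = n ∨ w = n) →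
      legs e (fun _ => a n) (E := G.incidenceSet n) (fun x => k ⟨x.1, x.2.1⟩) u w =
        legs e a k u w := by
    intro u w huw hn
    unfold legs
    rcases (hmem u w).1 huw with rfl | hadj
    · obtain rfl : w = n := hn.elim id id
      simp
    · have h1 : s(u, w) ∈ G.edgeSet := hadj
      have h2 : s(u, w) ∈ G.incidenceSet n := ⟨hadj, by rcases hn with rfl | rfl <;> simp⟩
      rw [dif_pos h1, dif_pos h2]
  congr 1
  · congr 1 <;> funext w <;> rw [hlegs _ _ w.2 (.inl rfl)]
  · refine congrArg (fun l : List (Matrix (Fin d) (Fin d) ℂ) => l.prod (t₀ n) (t n))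
      (congrArg List.ofFn (funext fun i => ?_))
    unfold siteFactor
    split_ifs with h
    · exact congrArg (fun p => Matrix.single p.1 p.2 (1 : ℂ)) (hlegs _ _ h (.inr rfl))
    · rfl

end Networks

/-! ### Networks for cellular automata -/

section Automata

variable {V : Type*} [Fintype V] [DecidableEq V] {d : ℕ} {G : SimpleGraph V}

theorem prod_map_conj {n : Type*} [Fintype n] [DecidableEq n] (U : Matrix.unitaryGroup n ℂ)
    (l : List (Matrix n n ℂ)) :
    (l.map fun X => U.1.conjTranspose * X * U.1).prod = U.1.conjTranspose * l.prod * U.1 := by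
  have h1 : U.1 * U.1.conjTranspose = 1 := Matrix.mem_unitaryGroup_iff.mp U.2
  have h2 : U.1.conjTranspose * U.1 = 1 := Matrix.mem_unitaryGroup_iff'.mp U.2
  induction l with
  | nil => simp [h2]
  | cons X l ih =>
    rw [List.map_cons, List.prod_cons, List.prod_cons, ih]
    calc _ = U.1.conjTranspose * X * (U.1 * U.1.conjTranspose) * l.prod * U.1 := by
          simp only [Matrix.mul_assoc]
      _ = _ := by rw [h1, Matrix.mul_one]; simp only [Matrix.mul_assoc]

theorem prod_map_unitOn (x y : Config V d) (l : List V) (hl : l.Nodup) :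
    (l.map fun v => unitOn {v} x y).prod = unitOn l.toFinset x y := by
  induction l with
  | nil =>
    simp only [List.map_nil, List.prod_nil, List.toFinset_nil, unitOn, Finset.notMem_empty,
      if_false]
    exact productOp_one.symm
  | cons v l ih =>
    rw [List.nodup_cons] at hl
    rw [List.map_cons, List.prod_cons, ih hl.2, List.toFinset_cons, Finset.insert_eq,
      unitOn_union (by simpa using hl.1)]

/-- For a nonzero matrix element `U s₀ t₀`, the product over the vertices of the evolved operators
`Uᴴ |s₀ v⟩⟨s v| U`, each of them supported on a closed neighborhood, is `Uᴴ |s₀⟩⟨s| U`, whose matrix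
elements at `(t₀, t)` are proportional to `U s t`. -/
theorem exists_contractWith_eq_of_local [NeZero d] [Nonempty V]
    (U : Matrix.unitaryGroup (Config V d) ℂ)
    (h : ∀ (v : V) (X : LocalOp {v} d), ∃ Y : LocalOp (regABar G {v}) d,
      (unitaryChannel U).adjoint (embed {v} X) = embed _ Y) :
    ∃ T : (n : V) → (G.incidenceSet n → Bool → Fin d × Fin d) → Fin d → Fin d → ℂ,
      contractWith T = (U : Op V d) := by
  obtain ⟨s₀, t₀, hU⟩ : ∃ s₀ t₀, U.1 s₀ t₀ ≠ 0 := by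
    by_contra! h0
    have h1 : U.1 * star U.1 = 1 := Matrix.mem_unitaryGroup_iff.mp U.2
    rw [show U.1 = 0 from Matrix.ext h0, zero_mul] at h1
    exact zero_ne_one h1
  have hy : ∀ (v : V) (c : Fin d), ∃ Y : LocalOp (regABar G {v}) d,
      U.1.conjTranspose * unitOn {v} s₀ (fun _ => c) * U.1 = embed _ Y := by
    intro v c
    rw [← adjoint_unitaryChannel, ← embed_single]
    exact h v _
  choose y hy using hy
  obtain ⟨T, hT⟩ := exists_contractWith_eq_prod (Fintype.equivFin V).symm y t₀
  obtain ⟨T', hT'⟩ := exists_contractWith_eq_smul T (star (U.1 s₀ t₀))⁻¹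
  refine ⟨T', hT'.trans ?_⟩
  ext s t
  have hs : ∀ v, embed _ (y v (s v)) = U.1.conjTranspose * unitOn {v} s₀ s * U.1 := by
    intro v
    rw [← hy, unitOn_congr (fun _ _ => rfl) (y' := s)]
    simp
  have hprod : (List.ofFn fun i => embed _ (y ((Fintype.equivFin V).symm i)
      (s ((Fintype.equivFin V).symm i)))).prod =
        U.1.conjTranspose * Matrix.single s₀ s 1 * U.1 := by
    have hl : (List.ofFn (Fintype.equivFin V).symm).toFinset = Finset.univ := by
      ext v
      simp only [List.mem_toFinset, List.mem_ofFn', Set.mem_range, Finset.mem_univ, iff_true]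
      exact (Fintype.equivFin V).symm.surjective v
    rw [← unitOn_univ, ← hl, ← prod_map_unitOn _ _ _
      (List.nodup_ofFn.2 (Fintype.equivFin V).symm.injective), ← prod_map_conj, List.map_map,
      List.map_ofFn]
    exact congrArg (fun l => (List.ofFn l).prod) (funext fun i => hs _)
  have hentry : (U.1.conjTranspose * Matrix.single s₀ s 1 * U.1 : Op V d) t₀ t =
      star (U.1 s₀ t₀) * U.1 s t := by
    rw [Matrix.mul_apply, Finset.sum_eq_single s]
    · simp
    · intro r _ hr
      rw [Matrix.mul_single_apply_of_ne _ _ _ _ _ hr, zero_mul]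
    · simp
  rw [Matrix.smul_apply, hT, hprod, hentry, smul_eq_mul, inv_mul_cancel_left₀ (star_ne_zero.2 hU)]

end Automata

/-! ### The hypercubic lattice -/

section Lattice

variable {dL M : ℕ} {bc : Boundary}

/-- Under either boundary condition, coordinates of neighbors differ by at most one modulo `M`. -/
theorem exists_int_of_adj {n m : Site dL M} (h : (latticeGraph dL M bc).Adj n m) (i : Fin dL) :
    ∃ z : ℤ, |z| ≤ 1 ∧ (M : ℤ) ∣ (m i : ℤ) - (n i : ℤ) - z := by
  have key : ∀ n m : Site dL M, ∀ j, ((m j : ℕ) = (n j : ℕ) + 1 ∨ (m j : ℕ) = ((n j : ℕ) + 1) % M) →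
      (∀ k, k ≠ j → m k = n k) → ∃ z : ℤ, |z| ≤ 1 ∧ (M : ℤ) ∣ (m i : ℤ) - (n i : ℤ) - z := by
    intro n m j hj hk
    by_cases hij : i = j
    · subst hij
      refine ⟨1, by simp, ?_⟩
      rcases hj with hj | hj
      · simp [hj]
      · obtain ⟨c, hc⟩ := Int.dvd_self_sub_emod (x := (n i : ℤ) + 1) (m := (M : ℤ))
        rw [hj]
        exact ⟨-c, by push_cast; linear_combination -hc⟩
    · exact ⟨0, by simp, by simp [hk i hij]⟩
  have key' : ∀ n m : Site dL M, (∃ z : ℤ, |z| ≤ 1 ∧ (M : ℤ) ∣ (n i : ℤ) - (m i : ℤ) - z) →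
      ∃ z : ℤ, |z| ≤ 1 ∧ (M : ℤ) ∣ (m i : ℤ) - (n i : ℤ) - z := by
    rintro n m ⟨z, hz, c, hc⟩
    exact ⟨-z, by rwa [abs_neg], -c, by linear_combination -hc⟩
  cases bc <;>
  · simp only [latticeGraph, SimpleGraph.fromRel_adj] at h
    obtain ⟨-, ⟨j, h1, h2⟩ | ⟨j, h1, h2⟩⟩ := h
    · exact key n m j (by simp [h1]) h2
    · exact key' n m (key m n j (by simp [h1]) h2)

theorem exists_int_of_walk {n m : Site dL M} (p : (latticeGraph dL M bc).Walk n m) (i : Fin dL) :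
    ∃ z : ℤ, |z| ≤ p.length ∧ (M : ℤ) ∣ (m i : ℤ) - (n i : ℤ) - z := by
  induction p with
  | nil => exact ⟨0, by simp⟩
  | cons h p ih =>
    obtain ⟨z, hz, c, hc⟩ := ih
    obtain ⟨z', hz', c', hc'⟩ := exists_int_of_adj h i
    refine ⟨z' + z, ?_, c' + c, by linear_combination hc + hc'⟩
    rw [SimpleGraph.Walk.length_cons]
    push_cast
    linarith [abs_add_le z' z]

/-- For side at least six, shifting one coordinate by three leads to distance three, so that single
vertices are admissible regions. -/
theorem admissible_singleton (hdL : 0 < dL) (hM : 6 ≤ M) (v : Site dL M) :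
    Admissible (latticeGraph dL M bc) {v} := by
  let i : Fin dL := ⟨0, hdL⟩
  refine ⟨Function.update v i ⟨((v i : ℕ) + 3) % M, Nat.mod_lt _ (by omega)⟩, ?_⟩
  by_contra h
  obtain ⟨m, hm, h⟩ := (notMem_regFar _ _).1 h
  rw [Finset.mem_singleton] at hm
  subst hm
  obtain ⟨p, hp⟩ := SimpleGraph.exists_walk_of_edist_ne_top
    (ne_top_of_le_ne_top (by simp) h)
  rw [← hp] at h
  have hlen : p.length ≤ 2 := by exact_mod_cast h
  obtain ⟨z, hz, hd⟩ := exists_int_of_walk p i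
  have hz2 : |z| ≤ 2 := hz.trans (by exact_mod_cast hlen)
  rw [abs_le] at hz2
  simp only [Function.update_self] at hd
  push_cast at hd
  have h3 : (M : ℤ) ∣ 3 + z := by
    obtain ⟨c, hc⟩ := hd
    obtain ⟨c', hc'⟩ := Int.dvd_self_sub_emod (x := (m i : ℤ) + 3) (m := (M : ℤ))
    exact ⟨c' - c, by linear_combination hc' - hc⟩
  have := Int.le_of_dvd (by linarith) h3
  omega

theorem preconnected_latticeGraph : (latticeGraph dL M bc).Preconnected := by
  have key : ∀ (k : ℕ) (n : Site dL M), ∑ i, (n i : ℕ) = k →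
      ∀ o : Site dL M, (∀ i, (o i : ℕ) = 0) → (latticeGraph dL M bc).Reachable n o := by
    intro k
    induction k with
    | zero =>
      intro n hn o ho
      have : n = o := funext fun i => Fin.ext (by
        rw [ho i]; exact Finset.sum_eq_zero_iff.1 hn i (Finset.mem_univ i))
      rw [this]
    | succ k ih =>
      intro n hn o ho
      obtain ⟨i, hi⟩ : ∃ i, (n i : ℕ) ≠ 0 := by
        by_contra! h
        simp [h] at hn
      let n' : Site dL M := Function.update n i ⟨(n i : ℕ) - 1, by omega⟩
      have hi' : (n i : ℕ) = (n' i : ℕ) + 1 := by simp [n']; omega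
      have hj : ∀ j, j ≠ i → n j = n' j := fun j hj => by simp [n', hj]
      have hadj : (latticeGraph dL M bc).Adj n n' := by
        have hne : n ≠ n' := fun h => by
          have := congrArg (fun x : Site dL M => (x i : ℕ)) h
          omega
        cases bc
        · exact (SimpleGraph.fromRel_adj _ _ _).2 ⟨hne, .inr ⟨i, hi', hj⟩⟩
        · exact (SimpleGraph.fromRel_adj _ _ _).2
            ⟨hne, .inr ⟨i, by rw [← hi', Nat.mod_eq_of_lt (n i).2], hj⟩⟩
      refine hadj.reachable.trans (ih n' ?_ o ho)
      rw [← Finset.add_sum_erase _ _ (Finset.mem_univ i)] at hn ⊢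
      rw [Finset.sum_congr rfl fun j h => by rw [hj j (Finset.ne_of_mem_erase h)]] at hn
      omega
  intro n m
  let o : Site dL M := fun i => ⟨0, (n i).pos⟩
  exact (key _ n rfl o fun _ => rfl).trans (key _ m rfl o fun _ => rfl).symm

end Lattice

/-- A cellular automaton on the lattice is a network of bounded bond dimension. On small lattices,
where few regions are admissible and causality preservation may say nothing, this is the bond
dimension that suffices for all operators. -/
theorem IsCPQC.exists_pepo {d dL M D : ℕ} {bc : Boundary} (hd : 0 < d) (hM : 4 ≤ M)
    {U : Matrix.unitaryGroup (Config (Site dL M) d) ℂ}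
    (hD : max (d ^ 4) (d ^ (2 * 5 ^ dL)) ≤ D)
    (h : IsCPQC (latticeGraph dL M bc) (unitaryChannel U)) :
    ∃ T : PEPO (latticeGraph dL M bc) d D, T.contract = (U : Op (Site dL M) d) := by
  have : NeZero d := ⟨hd.ne'⟩
  have : NeZero M := ⟨by omega⟩
  -- This covers both `M ≤ 5` and `dL = 0`.
  by_cases hsmall : M ^ dL ≤ 5 ^ dL
  · obtain ⟨T, hT⟩ := exists_contractWith_eq_of_preconnected
      (preconnected_latticeGraph (bc := bc)) (U : Op (Site dL M) d)
    have hcard : Fintype.card (Config (Site dL M) d × Config (Site dL M) d) ≤ D := by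
      refine le_trans ?_ ((le_max_right _ _).trans hD)
      simp only [Fintype.card_prod, Fintype.card_fun, Fintype.card_fin]
      rw [← pow_add, ← two_mul]
      exact Nat.pow_le_pow_right hd (Nat.mul_le_mul_left 2 hsmall)
    obtain ⟨T', hT'⟩ := exists_contract_eq_contractWith hcard T
    exact ⟨T', hT'.trans hT⟩
  · have hdL : 0 < dL := Nat.pos_of_ne_zero fun h => hsmall (by simp [h])
    have hM6 : 6 ≤ M := by
      by_contra h
      exact hsmall (Nat.pow_le_pow_left (by omega) dL)
    obtain ⟨T, hT⟩ := exists_contractWith_eq_of_local U fun v X =>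
      h {v} (admissible_singleton hdL hM6 v) X
    have hcard : Fintype.card (Bool → Fin d × Fin d) ≤ D := by
      refine le_trans (le_of_eq ?_) ((le_max_left _ _).trans hD)
      simp only [Fintype.card_prod, Fintype.card_fun, Fintype.card_fin, Fintype.card_bool]
      ring
    obtain ⟨T', hT'⟩ := exists_contract_eq_contractWith hcard T
    exact ⟨T', hT'.trans hT⟩

end QCA

theorem theorem1 :
    ∃ D₀ : ℕ → ℕ → ℕ → ℕ,
      ∀ (d dL M : ℕ) (bc : QCA.Boundary), 0 < d → 4 ≤ M →
        ∀ U : Matrix.unitaryGroup (QCA.Config (QCA.Site dL M) d) ℂ,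
          ∀ D : ℕ, D₀ d dL (2 * dL) ≤ D →
            List.TFAE
              [QCA.IsCPQC (QCA.latticeGraph dL M bc) (QCA.unitaryChannel U),
                QCA.IsLPQC (QCA.latticeGraph dL M bc) (QCA.unitaryChannel U),
                QCA.HasSimplePEPU (QCA.latticeGraph dL M bc) D U] := by
  refine ⟨fun d dL _ => max (d ^ 4) (d ^ (2 * 5 ^ dL)), fun d dL M bc hd hM U D hD => ?_⟩
  have : NeZero d := ⟨hd.ne'⟩
  tfae_have 1 → 3 := fun h => by
    obtain ⟨T, hT⟩ := h.exists_pepo hd hM hD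
    refine ⟨T, hT, (QCA.isSimple_iff_factorizes T).2 fun A hA => ?_⟩
    rw [hT]
    exact h.factorizes hA
  tfae_have 3 → 2 := fun ⟨T, hT, hs⟩ => QCA.isLPQC_iff_factorizes.2 fun A hA => by
    rw [← hT]
    exact (QCA.isSimple_iff_factorizes T).1 hs A hA
  tfae_have 2 → 1 := fun h => QCA.isCPQC_of_factorizes (QCA.isLPQC_iff_factorizes.1 h)
  tfae_finish
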